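/- For a compact set $K\subset\mathbb{C}$ and a continuous function $f:K\to\mathbb{C}$, put $\|h\|_K=\sup_{z\in K}|h(z)|$ and $$d_n(f,K)=\inf\{\|f-p\|_K : p\in\mathbb{C}[z],\ \deg p\le n\}.$$ A compact set $K\subset\mathbb{C}$ is called regular if there is a continuous function $g_K:\mathbb{C}\to[0,\infty)$ (its Green function, which is then unique) that vanishes identically on $K$, is harmonic on $\mathbb{C}\setminus K$, and is such that $g_K(z)-\log|z|$ is harmonic at infinity, i.e. $w\mapsto g_K(1/w)+\log|w|$ extends to a harmonic function in a neighborhood of $w=0$. **Theorem (Bernstein–Walsh).** Let $K\subset\mathbb{C}$ be a regular compact set with Green function $g_K$, let $R>1$, and let $D_R=\{z\in\mathbb{C}: g_K(z)<\log R\}$. Let $f$ be continuous on $K$. Then $$\limsup_{n\to\infty} d_n(f,K)^{1/n}\le \frac1R$$ if and only if $f$ is the restriction to $K$ of a function holomorphic on $D_R$. -/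

import Mathlib

/-- `g` is the Green function (with pole at infinity) of the compact set `K ⊆ ℂ`: it is continuous,
nonnegative, zero on `K`, harmonic off `K`, and `g z - log |z|` is harmonic at infinity, that is,
`w ↦ g (1 / w) - log |1 / w| = g (1 / w) + log |w|` extends harmonically across `w = 0`.
A compact set is regular if it has such a function (which is then unique). -/
structure IsGreenFunction (K : Set ℂ) (g : ℂ → ℝ) : Prop where
  continuous : Continuous g
  nonneg : ∀ z, 0 ≤ g z
  eq_zero : ∀ z ∈ K, g z = 0
  harmonic : InnerProductSpace.HarmonicOnNhd g Kᶜ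
  harmonic_at_infinity : ∃ h : ℂ → ℝ, InnerProductSpace.HarmonicAt h 0 ∧
    ∀ᶠ w in nhdsWithin (0 : ℂ) {0}ᶜ, h w = g w⁻¹ - Real.log ‖w⁻¹‖

/-- The supremum norm of `f` on `K` (for `K` nonempty and `f` bounded on `K`). -/
noncomputable def supNormOn (K : Set ℂ) (f : ℂ → ℂ) : ℝ :=
  sSup ((fun z => ‖f z‖) '' K)

/-- The error `d_n(f, K)` of best uniform approximation of `f` on `K` by complex polynomials of
degree at most `n`. -/
noncomputable def approxError (n : ℕ) (f : ℂ → ℂ) (K : Set ℂ) : ℝ :=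
  ⨅ p : {p : Polynomial ℂ // p.natDegree ≤ n}, supNormOn K (fun z => f z - p.1.eval z)

/-- The sublevel set `D_R = {z : g z < log R}`. -/
def greenSublevel (g : ℂ → ℝ) (R : ℝ) : Set ℂ :=
  {z | g z < Real.log R}

open Filter Topology InnerProductSpace Set Metric MeasureTheory

/-! Both directions rest on one maximum principle for `‖H‖ * exp (a * g)`, with `H` holomorphic and
vector-valued.

Approximation gives extension: applied to a polynomial off `K`, the principle yields the
Bernstein–Walsh inequality `norm_eval_le`. Successive differences of near-best polynomials are
`O(q^n)` on `K` for any `q > 1/R` below 1, hence `O((q r)^n)` on `D_r`; choosing `q < 1/r`, the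
telescoping series converges and defines the extension.

Extension gives approximation: the Cauchy kernel `ζ ↦ 1/(ζ - ·)` is the resolvent of the coordinate
function in `C(K, ℂ)`. Its class modulo polynomials of degree at most `n` vanishes at infinity
faster than `|ζ|^{-(n+1)}`, so the maximum principle, now with values in the quotient space, bounds
it by a constant times `exp ((n+1)(s - g ζ))` (`exists_norm_mkQ_resolvent_le`). Cutting `F` off
smoothly along level sets of `g` and applying Cauchy–Pompeiu writes `f` as an integral of such
kernels over `g ≥ b`, with `b` close to `log R`. No interpolation nodes or contours are needed. -/

/-! ### Maximum principle -/

/-- Locally `g = Re G` with `G` holomorphic, so the product is the norm of the holomorphic function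
`exp (a G) • H`. -/
theorem eventually_eq_of_isLocalMax_norm_mul_exp_harmonic {E : Type*} [NormedAddCommGroup E]
    [NormedSpace ℂ E] {H : ℂ → E} {g : ℂ → ℝ} {z₀ : ℂ}
    (hH : ∀ᶠ z in 𝓝 z₀, DifferentiableAt ℂ H z) (hg : HarmonicAt g z₀) (a : ℝ)
    (hmax : IsLocalMax (fun z => ‖H z‖ * Real.exp (a * g z)) z₀) :
    ∀ᶠ z in 𝓝 z₀, ‖H z‖ * Real.exp (a * g z) = ‖H z₀‖ * Real.exp (a * g z₀) := by
  obtain ⟨r, hr, hball⟩ := Metric.eventually_nhds_iff_ball.1 hg.eventually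
  obtain ⟨G, hG, hGg⟩ := HarmonicOnNhd.exists_analyticOnNhd_ball_re_eq (f := g) (z := z₀) (R := r)
    (fun x hx => hball x hx)
  have key : ∀ z ∈ ball z₀ r, ‖Complex.exp (a * G z) • H z‖ = ‖H z‖ * Real.exp (a * g z) := by
    intro z hz
    rw [norm_smul, Complex.norm_exp, mul_comm, Complex.re_ofReal_mul]
    rw [show (G z).re = g z from hGg hz]
  have hev : ∀ᶠ z in 𝓝 z₀, ‖Complex.exp (a * G z) • H z‖ = ‖H z‖ * Real.exp (a * g z) :=
    eventually_of_mem (ball_mem_nhds z₀ hr) key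
  have hd : ∀ᶠ z in 𝓝 z₀, DifferentiableAt ℂ (fun z => Complex.exp (a * G z) • H z) z := by
    filter_upwards [hH, ball_mem_nhds z₀ hr] with z hz hzb
    exact (((hG z hzb).differentiableAt.const_mul _).cexp).smul hz
  have hm : IsLocalMax (norm ∘ fun z => Complex.exp (a * G z) • H z) z₀ :=
    hmax.congr (hev.mono fun z hz => hz.symm)
  filter_upwards [Complex.norm_eventually_eq_of_isLocalMax hd hm, hev] with z h1 h2
  rw [← h2, h1, hev.self_of_nhds]

/-- If the bound failed, the maximum over `closure Ω` would exceed `M`, so it would be attained only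
inside `Ω`. The set where it is attained is then clopen in `ℂ`, hence everything, against decay at
infinity. `Ω` may be unbounded or disconnected. -/
theorem norm_mul_exp_harmonic_le_of_forall_mem_frontier {E : Type*} [NormedAddCommGroup E]
    [NormedSpace ℂ E] {H : ℂ → E} {g : ℂ → ℝ} {Ω : Set ℂ} (hΩ : IsOpen Ω)
    (hH : DiffContOnCl ℂ H Ω) (hgc : Continuous g) (hg : HarmonicOnNhd g Ω) (a : ℝ)
    (hlim : Tendsto (fun z => ‖H z‖ * Real.exp (a * g z)) (cocompact ℂ) (𝓝 0))
    {M : ℝ} (hM : 0 ≤ M) (hfr : ∀ z ∈ frontier Ω, ‖H z‖ * Real.exp (a * g z) ≤ M)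
    {z : ℂ} (hz : z ∈ Ω) : ‖H z‖ * Real.exp (a * g z) ≤ M := by
  by_contra! hlt
  set v : ℂ → ℝ := fun z => ‖H z‖ * Real.exp (a * g z) with hv
  have hvc : ContinuousOn v (closure Ω) :=
    hH.continuousOn.norm.mul (by fun_prop)
  have hvz : 0 < v z := hM.trans_lt hlt
  obtain ⟨z₀, hz₀, hmax⟩ := hvc.exists_isMaxOn' isClosed_closure (subset_closure hz)
    ((hlim.eventually (gt_mem_nhds hvz)).filter_mono inf_le_left |>.mono fun _ h => h.le)
  have hzz₀ : v z ≤ v z₀ := hmax (subset_closure hz)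
  set A := {x ∈ closure Ω | v z₀ ≤ v x} with hA
  have hAc : IsClosed A := hvc.preimage_isClosed_of_isClosed isClosed_closure isClosed_Ici
  have hAo : IsOpen A := by
    rw [isOpen_iff_mem_nhds]
    rintro x ⟨hx, hvx⟩
    have hxΩ : x ∈ Ω := by
      by_contra hxn
      have := hfr x ⟨hx, by rwa [hΩ.interior_eq]⟩
      exact absurd (hlt.trans_le (hzz₀.trans hvx)) (not_lt.2 this)
    have hΩx := hΩ.mem_nhds hxΩ
    have hloc : IsLocalMax v x := by
      filter_upwards [hΩx] with y hy
      exact (hmax (subset_closure hy)).trans hvx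
    filter_upwards [hΩx, eventually_eq_of_isLocalMax_norm_mul_exp_harmonic
      (hH.differentiableOn.eventually_differentiableAt hΩx) (hg x hxΩ) a hloc] with y hy hvy
    exact ⟨subset_closure hy, hvx.trans_eq hvy.symm⟩
  have hAuniv : A = univ := (isClopen_iff.1 ⟨hAc, hAo⟩).resolve_left
    (Set.Nonempty.ne_empty ⟨z₀, hz₀, le_rfl⟩)
  obtain ⟨y, hy⟩ := (hlim.eventually (gt_mem_nhds (hvz.trans_le hzz₀))).exists
  have hyA : y ∈ A := hAuniv ▸ mem_univ y
  exact absurd hyA.2 (not_le.2 hy)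

/-! ### Growth of the Green function and the Bernstein–Walsh inequality -/

namespace IsGreenFunction

variable {K : Set ℂ} {g : ℂ → ℝ}

theorem exists_abs_sub_log_norm_le (hg : IsGreenFunction K g) :
    ∃ C, ∀ᶠ z in cocompact ℂ, |g z - Real.log ‖z‖| ≤ C := by
  obtain ⟨h, hh, he⟩ := hg.harmonic_at_infinity
  have hc : ContinuousAt h 0 := hh.1.continuousAt
  refine ⟨|h 0| + 1, ?_⟩
  have h1 : ∀ᶠ w in 𝓝 (0 : ℂ), |h w| < |h 0| + 1 := hc.abs.eventually (gt_mem_nhds (by linarith))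
  have h2 : ∀ᶠ w in 𝓝[≠] (0 : ℂ), |g w⁻¹ - Real.log ‖w⁻¹‖| ≤ |h 0| + 1 := by
    filter_upwards [he, h1.filter_mono nhdsWithin_le_nhds] with w hw1 hw2
    rw [← hw1]; exact hw2.le
  have h3 := (tendsto_inv₀_cobounded' (α := ℂ)).eventually h2
  rw [← Metric.cobounded_eq_cocompact]
  simpa using h3

theorem tendsto_cocompact (hg : IsGreenFunction K g) : Tendsto g (cocompact ℂ) atTop := by
  obtain ⟨C, hC⟩ := hg.exists_abs_sub_log_norm_le
  have h1 : Tendsto (fun z : ℂ => Real.log ‖z‖ - C) (cocompact ℂ) atTop :=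
    tendsto_atTop_add_const_right _ _ (Real.tendsto_log_atTop.comp (tendsto_norm_cocompact_atTop (E := ℂ)))
  refine tendsto_atTop_mono' _ ?_ h1
  filter_upwards [hC] with z hz
  linarith [(abs_le.1 hz).1]

theorem exists_norm_le_exp (hg : IsGreenFunction K g) :
    ∃ C, ∀ᶠ z in cocompact ℂ, 1 ≤ ‖z‖ ∧ ‖z‖ ≤ Real.exp (g z + C) ∧ Real.exp (g z) ≤
      Real.exp C * ‖z‖ := by
  obtain ⟨C, hC⟩ := hg.exists_abs_sub_log_norm_le
  refine ⟨C, ?_⟩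
  filter_upwards [hC, (tendsto_norm_cocompact_atTop (E := ℂ)).eventually_ge_atTop 1] with z hz h1
  have h0 : 0 < ‖z‖ := by linarith
  have := abs_le.1 hz
  refine ⟨h1, ?_, ?_⟩
  · rw [← Real.log_le_iff_le_exp h0]; linarith
  · refine (Real.exp_le_exp.2 (show g z ≤ C + Real.log ‖z‖ by linarith)).trans_eq ?_
    rw [Real.exp_add, Real.exp_log h0]

theorem notMem_of_pos (hg : IsGreenFunction K g) {z : ℂ} (hz : 0 < g z) : z ∉ K :=
  fun h => hz.ne' (hg.eq_zero z h)

theorem isOpen_greenSublevel (hg : IsGreenFunction K g) (R : ℝ) : IsOpen (greenSublevel g R) :=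
  isOpen_lt hg.continuous continuous_const

theorem isCompact_setOf_le (hg : IsGreenFunction K g) (c : ℝ) : IsCompact {z | g z ≤ c} := by
  have hcl : IsClosed {z | g z ≤ c} := isClosed_le hg.continuous continuous_const
  obtain ⟨t, ht, hts⟩ := mem_cocompact.1 (hg.tendsto_cocompact.eventually_gt_atTop c)
  refine ht.of_isClosed_subset hcl fun z hz => ?_
  by_contra h
  exact absurd (show c < g z from hts h) (not_lt.2 hz)

/-- The **Bernstein–Walsh inequality**. -/
theorem norm_eval_le (hg : IsGreenFunction K g) (hK : IsCompact K) {p : Polynomial ℂ} {n : ℕ}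
    (hp : p.natDegree ≤ n) {M : ℝ} (hM : 0 ≤ M) (hpM : ∀ z ∈ K, ‖p.eval z‖ ≤ M) (z : ℂ) :
    ‖p.eval z‖ ≤ M * Real.exp (n * g z) := by
  by_cases hzK : z ∈ K
  · simpa [hg.eq_zero z hzK] using hpM z hzK
  -- With weight `exp (-n g)` the quotient is merely bounded at infinity; the extra `ε` makes it
  -- decay.
  have key : ∀ ε > 0, ‖p.eval z‖ ≤ M * Real.exp ((n + ε) * g z) := by
    intro ε hε
    have hlim : Tendsto (fun z => ‖p.eval z‖ * Real.exp (-(n + ε) * g z)) (cocompact ℂ) (𝓝 0) := by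
      obtain ⟨C, hC⟩ := hg.exists_norm_le_exp
      set S := ∑ i ∈ Finset.range (n + 1), ‖p.coeff i‖
      have h1 : Tendsto (fun z => S * Real.exp (n * C) * Real.exp (-(ε * g z))) (cocompact ℂ)
          (𝓝 0) := by
        have := ((Real.tendsto_exp_neg_atTop_nhds_zero.comp
          (hg.tendsto_cocompact.const_mul_atTop hε)).const_mul (S * Real.exp (n * C)))
        simpa using this
      refine squeeze_zero' (Eventually.of_forall fun z => by positivity) ?_ h1
      filter_upwards [hC] with w hw
      have h2 : ‖p.eval w‖ ≤ S * ‖w‖ ^ n := by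
        rw [Polynomial.eval_eq_sum_range' (Nat.lt_succ_of_le hp), Finset.sum_mul]
        refine (norm_sum_le _ _).trans (Finset.sum_le_sum fun i hi => ?_)
        rw [norm_mul, norm_pow]
        gcongr
        · exact hw.1
        · exact Nat.lt_succ_iff.1 (Finset.mem_range.1 hi)
      have h3 : ‖w‖ ^ n ≤ Real.exp (n * (g w + C)) := by
        rw [Real.exp_nat_mul]
        exact pow_le_pow_left₀ (norm_nonneg _) hw.2.1 n
      calc ‖p.eval w‖ * Real.exp (-(n + ε) * g w)
          ≤ S * Real.exp (n * (g w + C)) * Real.exp (-(n + ε) * g w) := by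
            gcongr; exact h2.trans (by gcongr)
        _ = S * Real.exp (n * C) * Real.exp (-(ε * g w)) := by
            rw [mul_assoc, mul_assoc, ← Real.exp_add, ← Real.exp_add]; ring_nf
    have h := norm_mul_exp_harmonic_le_of_forall_mem_frontier (H := fun z => p.eval z)
      hK.isClosed.isOpen_compl (p.differentiable.diffContOnCl) hg.continuous hg.harmonic _ hlim hM
      (fun w hw => ?_) (show z ∈ Kᶜ from hzK)
    · rw [neg_mul, Real.exp_neg, ← div_eq_mul_inv, div_le_iff₀ (Real.exp_pos _)] at h
      exact h
    · have hwK : w ∈ K := by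
        rw [frontier_compl] at hw
        exact hK.isClosed.frontier_subset hw
      simpa [hg.eq_zero w hwK] using hpM w hwK
  have hlim : Tendsto (fun ε : ℝ => M * Real.exp ((n + ε) * g z)) (𝓝[>] 0)
      (𝓝 (M * Real.exp ((n + 0) * g z))) :=
    ((by fun_prop : Continuous fun ε : ℝ => M * Real.exp ((n + ε) * g z)).tendsto 0).mono_left
      nhdsWithin_le_nhds
  simpa using ge_of_tendsto hlim (eventually_of_mem self_mem_nhdsWithin key)

end IsGreenFunction

/-! ### Approximation errors and geometric rates -/

theorem supNormOn_nonneg (K : Set ℂ) (f : ℂ → ℂ) : 0 ≤ supNormOn K f :=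
  Real.sSup_nonneg (by rintro _ ⟨z, -, rfl⟩; exact norm_nonneg _)

theorem norm_le_supNormOn {K : Set ℂ} (hK : IsCompact K) {f : ℂ → ℂ} (hf : ContinuousOn f K)
    {z : ℂ} (hz : z ∈ K) : ‖f z‖ ≤ supNormOn K f :=
  le_csSup (hK.bddAbove_image hf.norm) (mem_image_of_mem _ hz)

theorem supNormOn_le {K : Set ℂ} {f : ℂ → ℂ} {M : ℝ} (hM : 0 ≤ M) (h : ∀ z ∈ K, ‖f z‖ ≤ M) :
    supNormOn K f ≤ M :=
  Real.sSup_le (by rintro _ ⟨z, hz, rfl⟩; exact h z hz) hM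

theorem approxError_nonneg (n : ℕ) (f : ℂ → ℂ) (K : Set ℂ) : 0 ≤ approxError n f K :=
  Real.iInf_nonneg fun _ => supNormOn_nonneg _ _

theorem approxError_le {n : ℕ} {p : Polynomial ℂ} (hp : p.natDegree ≤ n) (f : ℂ → ℂ)
    (K : Set ℂ) : approxError n f K ≤ supNormOn K (fun z => f z - p.eval z) :=
  ciInf_le (f := fun p : {p : Polynomial ℂ // p.natDegree ≤ n} =>
    supNormOn K (fun z => f z - p.1.eval z))
    ⟨0, by rintro _ ⟨q, rfl⟩; exact supNormOn_nonneg _ _⟩ ⟨p, hp⟩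

theorem exists_supNormOn_lt_approxError_add (n : ℕ) (f : ℂ → ℂ) (K : Set ℂ) {ε : ℝ}
    (hε : 0 < ε) : ∃ p : Polynomial ℂ, p.natDegree ≤ n ∧
      supNormOn K (fun z => f z - p.eval z) < approxError n f K + ε := by
  have : Nonempty {p : Polynomial ℂ // p.natDegree ≤ n} := ⟨⟨0, by simp⟩⟩
  obtain ⟨p, hp⟩ := exists_lt_of_ciInf_lt (lt_add_of_pos_right (approxError n f K) hε)
  exact ⟨p.1, p.2, hp⟩

/-- The zero polynomial is a competitor. The bound, uniform in `n`, is what makes the real-valued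
`limsup` meaningful. -/
theorem approxError_rpow_le (n : ℕ) (f : ℂ → ℂ) (K : Set ℂ) :
    approxError n f K ^ (1 / (n : ℝ)) ≤ max 1 (supNormOn K f) := by
  have h0 : approxError n f K ≤ supNormOn K f := by
    simpa using approxError_le (n := n) (p := 0) (by simp) f K
  have hn : 1 / (n : ℝ) ≤ 1 := by
    rcases Nat.eq_zero_or_pos n with rfl | hn
    · simp
    · rw [div_le_one (by exact_mod_cast hn)]; exact_mod_cast hn
  calc approxError n f K ^ (1 / (n : ℝ)) ≤ (max 1 (supNormOn K f)) ^ (1 / (n : ℝ)) :=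
        Real.rpow_le_rpow (approxError_nonneg _ _ _) (h0.trans (le_max_right _ _)) (by positivity)
    _ ≤ (max 1 (supNormOn K f)) ^ (1 : ℝ) :=
        Real.rpow_le_rpow_of_exponent_le (le_max_left _ _) hn
    _ = _ := Real.rpow_one _

theorem isBoundedUnder_approxError_rpow (f : ℂ → ℂ) (K : Set ℂ) :
    IsBoundedUnder (· ≤ ·) atTop fun n : ℕ => approxError n f K ^ (1 / (n : ℝ)) :=
  isBoundedUnder_of ⟨_, fun n => approxError_rpow_le n f K⟩

theorem isCoboundedUnder_approxError_rpow (f : ℂ → ℂ) (K : Set ℂ) :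
    IsCoboundedUnder (· ≤ ·) atTop fun n : ℕ => approxError n f K ^ (1 / (n : ℝ)) :=
  IsBoundedUnder.isCoboundedUnder_le
    (isBoundedUnder_of ⟨0, fun n => Real.rpow_nonneg (approxError_nonneg n f K) _⟩)

theorem exists_approxError_le_mul_pow {f : ℂ → ℂ} {K : Set ℂ} {q : ℝ} (hq : 0 < q)
    (h : limsup (fun n : ℕ => approxError n f K ^ (1 / (n : ℝ))) atTop < q) :
    ∃ C > 0, ∀ n, approxError n f K ≤ C * q ^ n := by
  have hev := eventually_lt_of_limsup_lt h (isBoundedUnder_approxError_rpow f K)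
  have hO : (fun n => approxError n f K) =O[atTop] fun n : ℕ => q ^ n := by
    refine Asymptotics.IsBigO.of_bound 1 ?_
    filter_upwards [hev, eventually_gt_atTop 0] with n hn hn0
    have hn' : (n : ℝ) ≠ 0 := by exact_mod_cast hn0.ne'
    rw [Real.norm_of_nonneg (approxError_nonneg n f K), Real.norm_of_nonneg (by positivity), one_mul]
    calc approxError n f K = (approxError n f K ^ (1 / (n : ℝ))) ^ n := by
          rw [← Real.rpow_natCast, ← Real.rpow_mul (approxError_nonneg n f K),
            one_div_mul_cancel hn', Real.rpow_one]
      _ ≤ q ^ n := pow_le_pow_left₀ (Real.rpow_nonneg (approxError_nonneg n f K) _) hn.le n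
  obtain ⟨C, hC, hb⟩ := Asymptotics.bound_of_isBigO_nat_atTop hO
  refine ⟨C, hC, fun n => ?_⟩
  have := hb (x := n) (by positivity)
  rwa [Real.norm_of_nonneg (approxError_nonneg n f K), Real.norm_of_nonneg (by positivity)] at this

theorem limsup_approxError_rpow_le {f : ℂ → ℂ} {K : Set ℂ} {C q : ℝ} (hq : 0 < q)
    (h : ∀ n, approxError n f K ≤ C * q ^ n) :
    limsup (fun n : ℕ => approxError n f K ^ (1 / (n : ℝ))) atTop ≤ q := by
  -- `C` need not be positive; `B > 0` ensures `B ^ (1 / n) → 1`.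
  set B := max C 1
  have hB : 0 < B := lt_max_of_lt_right one_pos
  have hlim : Tendsto (fun n : ℕ => B ^ (1 / (n : ℝ)) * q) atTop (𝓝 q) := by
    have h1 : Tendsto (fun n : ℕ => B ^ (1 / (n : ℝ))) atTop (𝓝 (B ^ (0 : ℝ))) :=
      tendsto_const_nhds.rpow tendsto_one_div_atTop_nhds_zero_nat (Or.inl hB.ne')
    simpa using h1.mul_const q
  rw [← hlim.limsup_eq]
  refine limsup_le_limsup ?_ (isCoboundedUnder_approxError_rpow f K) hlim.isBoundedUnder_le
  filter_upwards [eventually_gt_atTop 0] with n hn0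
  have hn' : (n : ℝ) ≠ 0 := by exact_mod_cast hn0.ne'
  calc approxError n f K ^ (1 / (n : ℝ)) ≤ (B * q ^ n) ^ (1 / (n : ℝ)) :=
        Real.rpow_le_rpow (approxError_nonneg _ _ _)
          ((h n).trans (by gcongr; exact le_max_left _ _)) (by positivity)
    _ = B ^ (1 / (n : ℝ)) * q := by
        rw [Real.mul_rpow hB.le (by positivity), ← Real.rpow_natCast, ← Real.rpow_mul hq.le,
          mul_one_div_cancel hn', Real.rpow_one]

/-! ### From approximation to holomorphic extension -/

theorem IsGreenFunction.exists_differentiableOn_of_limsup_le {K : Set ℂ} {g : ℂ → ℝ}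
    (hg : IsGreenFunction K g) (hK : IsCompact K) {R : ℝ} (hR : 1 < R) {f : ℂ → ℂ}
    (hf : ContinuousOn f K)
    (h : limsup (fun n : ℕ => approxError n f K ^ (1 / (n : ℝ))) atTop ≤ 1 / R) :
    ∃ F : ℂ → ℂ, DifferentiableOn ℂ F (greenSublevel g R) ∧ EqOn F f K := by
  have hR0 : 0 < R := one_pos.trans hR
  -- Best approximants are not needed: a slack of `(1 / R) ^ n` is absorbed by any rate `q > 1 / R`.
  have hex (n : ℕ) := exists_supNormOn_lt_approxError_add n f K (ε := (1 / R) ^ n) (by positivity)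
  choose p hpdeg hp using hex
  have hpK : ∀ n, ∀ z ∈ K, ‖f z - (p n).eval z‖ ≤ approxError n f K + (1 / R) ^ n := fun n z hz =>
    (norm_le_supNormOn hK (f := fun z => f z - (p n).eval z)
      (hf.sub (p n).continuous.continuousOn) hz).trans (hp n).le
  have herr : ∀ q, 1 / R < q → q < 1 → ∃ C > 0, ∀ n, ∀ z ∈ K,
      ‖f z - (p n).eval z‖ ≤ C * q ^ n := by
    intro q hq hq1
    have hq0 : 0 < q := lt_trans (by positivity) hq
    obtain ⟨C, hC, hCn⟩ := exists_approxError_le_mul_pow hq0 (h.trans_lt hq)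
    refine ⟨C + 1, by positivity, fun n z hz => (hpK n z hz).trans ?_⟩
    rw [add_mul, one_mul]
    exact add_le_add (hCn n) (pow_le_pow_left₀ (by positivity) hq.le n)
  have hbound : ∀ r, 1 < r → r < R → ∃ u : ℕ → ℝ, Summable u ∧
      ∀ n, ∀ z ∈ greenSublevel g r, ‖(p (n + 1) - p n).eval z‖ ≤ u n := by
    intro r hr1 hrR
    have hr0 : 0 < r := one_pos.trans hr1
    -- `1/R < q` is an admissible rate on `K`, and `q < 1/r` makes `q r < 1`.
    obtain ⟨q, hq, hqr⟩ := exists_between (one_div_lt_one_div_of_lt hr0 hrR)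
    have hq0 : 0 < q := lt_trans (by positivity) hq
    have hq1 : q < 1 := hqr.trans (by rw [div_lt_one hr0]; exact hr1)
    obtain ⟨C, hC, hCn⟩ := herr q hq hq1
    refine ⟨fun n => 2 * C * r * (q * r) ^ n, ?_, fun n z hz => ?_⟩
    · refine (summable_geometric_of_lt_one (by positivity) ?_).mul_left _
      rwa [lt_div_iff₀ hr0] at hqr
    · have hM : ∀ w ∈ K, ‖(p (n + 1) - p n).eval w‖ ≤ 2 * C * q ^ n := by
        intro w hw
        have e : (p (n + 1) - p n).eval w
            = (f w - (p n).eval w) - (f w - (p (n + 1)).eval w) := by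
          rw [Polynomial.eval_sub]; ring
        have h1 : q ^ (n + 1) ≤ q ^ n := pow_le_pow_of_le_one hq0.le hq1.le n.le_succ
        rw [e]
        calc _ ≤ C * q ^ n + C * q ^ (n + 1) :=
              (norm_sub_le _ _).trans (add_le_add (hCn n w hw) (hCn (n + 1) w hw))
          _ ≤ C * q ^ n + C * q ^ n := by gcongr
          _ = _ := by ring
      have hdeg : (p (n + 1) - p n).natDegree ≤ n + 1 :=
        (Polynomial.natDegree_sub_le _ _).trans (max_le (hpdeg _) ((hpdeg n).trans n.le_succ))
      refine (hg.norm_eval_le hK hdeg (by positivity) hM z).trans ?_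
      have hexp : Real.exp ((n + 1 : ℕ) * g z) ≤ r ^ (n + 1) := by
        rw [Real.exp_nat_mul]
        refine pow_le_pow_left₀ (Real.exp_pos _).le ?_ _
        rw [← Real.le_log_iff_exp_le hr0]
        exact le_of_lt hz
      calc _ ≤ 2 * C * q ^ n * r ^ (n + 1) := by gcongr
        _ = _ := by simp only [mul_pow]; ring
  have hmem : ∀ z ∈ greenSublevel g R, ∃ r, 1 < r ∧ r < R ∧ z ∈ greenSublevel g r := by
    intro z hz
    have hz' : Real.exp (g z) < R := (Real.lt_log_iff_exp_lt hR0).1 hz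
    obtain ⟨r, hr, hrR⟩ := exists_between (max_lt hR hz')
    have hr1 : 1 < r := (le_max_left _ _).trans_lt hr
    exact ⟨r, hr1, hrR, (Real.lt_log_iff_exp_lt (one_pos.trans hr1)).2
      ((le_max_right _ _).trans_lt hr)⟩
  refine ⟨fun z => (p 0).eval z + ∑' n, (p (n + 1) - p n).eval z, fun z hz => ?_, fun z hz => ?_⟩
  · obtain ⟨r, hr1, hrR, hzr⟩ := hmem z hz
    obtain ⟨u, hu, hun⟩ := hbound r hr1 hrR
    have hd : DifferentiableOn ℂ (fun z => ∑' n, (p (n + 1) - p n).eval z) (greenSublevel g r) :=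
      Complex.differentiableOn_tsum_of_summable_norm hu
        (fun n => (p (n + 1) - p n).differentiable.differentiableOn) (hg.isOpen_greenSublevel r)
        hun
    exact ((p 0).differentiable.differentiableAt.add
      (hd.differentiableAt ((hg.isOpen_greenSublevel r).mem_nhds hzr))).differentiableWithinAt
  · have hzR : z ∈ greenSublevel g R := by
      change g z < Real.log R
      rw [hg.eq_zero z hz]; exact Real.log_pos hR
    obtain ⟨r, hr1, hrR, hzr⟩ := hmem z hzR
    obtain ⟨u, hu, hun⟩ := hbound r hr1 hrR
    have hs : Summable fun n => (p (n + 1) - p n).eval z :=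
      Summable.of_norm_bounded hu fun n => hun n z hzr
    have hpart : Tendsto (fun n => (p n).eval z) atTop
        (𝓝 ((p 0).eval z + ∑' n, (p (n + 1) - p n).eval z)) := by
      refine (hs.hasSum.tendsto_sum_nat.const_add ((p 0).eval z)).congr fun n => ?_
      simp only [Polynomial.eval_sub]
      rw [Finset.sum_range_sub (fun n => (p n).eval z)]; ring
    obtain ⟨q, hq, hq1⟩ := exists_between (show 1 / R < 1 by rw [div_lt_one hR0]; exact hR)
    obtain ⟨C, hC, hCn⟩ := herr q hq hq1
    have hpf : Tendsto (fun n => (p n).eval z) atTop (𝓝 (f z)) := by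
      rw [tendsto_iff_norm_sub_tendsto_zero]
      have hq0 : 0 ≤ q := le_trans (by positivity) hq.le
      refine squeeze_zero (g := fun n => C * q ^ n) (fun n => norm_nonneg _)
        (fun n => by rw [norm_sub_rev]; exact hCn n z hz) ?_
      simpa using (tendsto_pow_atTop_nhds_zero_of_lt_one hq0 hq1).const_mul C
    exact tendsto_nhds_unique hpart hpf

/-! ### Cauchy–Pompeiu formula -/

/-- The Cauchy–Riemann operator `∂u/∂z̄ = (∂u/∂x + i ∂u/∂y) / 2`. -/
noncomputable def dbar (u : ℂ → ℂ) (z : ℂ) : ℂ :=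
  (fderiv ℝ u z 1 + Complex.I * fderiv ℝ u z Complex.I) / 2

theorem integrableOn_polar_of_eq_zero {A : ℝ × ℝ → ℂ} (hA : Continuous A) {ρ : ℝ}
    (h : ∀ p : ℝ × ℝ, ρ < p.1 → A p = 0) :
    IntegrableOn A (Ioi 0 ×ˢ Ioo (-Real.pi) Real.pi) := by
  have h1 : IntegrableOn A (Icc 0 ρ ×ˢ Icc (-Real.pi) Real.pi) :=
    hA.continuousOn.integrableOn_compact (isCompact_Icc.prod isCompact_Icc)
  refine h1.of_forall_sdiff_eq_zero (measurableSet_Ioi.prod measurableSet_Ioo) ?_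
  rintro ⟨r, θ⟩ ⟨⟨hr, hθ⟩, hn⟩
  refine h _ ?_
  by_contra! hle
  exact hn ⟨⟨(mem_Ioi.1 hr).le, hle⟩, Ioo_subset_Icc_self hθ⟩

/-- In polar coordinates the Jacobian cancels the pole and the integrand becomes `(A + i B) / 2`,
where `A = ∂u/∂r` and `B = r⁻¹ ∂u/∂θ`. Along each ray `A` integrates to `-u 0`; around each circle
`B` integrates to 0. -/
theorem integral_dbar_mul_inv {u : ℂ → ℂ} (hu : ContDiff ℝ 1 u) (hc : HasCompactSupport u) :
    ∫ ζ, dbar u ζ * ζ⁻¹ = -(Real.pi * u 0) := by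
  set e : ℝ → ℂ := fun θ => Complex.exp (θ * Complex.I) with he
  have hec : Continuous e := by fun_prop
  have hDc : Continuous fun q : ℂ × ℂ => fderiv ℝ u q.1 q.2 :=
    (hu.continuous_fderiv one_ne_zero).fst'.clm_apply continuous_snd
  set A : ℝ × ℝ → ℂ := fun p => fderiv ℝ u (p.1 * e p.2) (e p.2) with hAdef
  set B : ℝ × ℝ → ℂ := fun p => fderiv ℝ u (p.1 * e p.2) (Complex.I * e p.2) with hBdef
  have hPc : Continuous fun p : ℝ × ℝ => (p.1 : ℂ) * e p.2 :=
    (Complex.continuous_ofReal.comp continuous_fst).mul (hec.comp continuous_snd)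
  have hAc : Continuous A := hDc.comp (hPc.prodMk (hec.comp continuous_snd))
  have hBc : Continuous B :=
    hDc.comp (hPc.prodMk (continuous_const.mul (hec.comp continuous_snd)))
  have hnorm : ∀ θ, ‖e θ‖ = 1 := fun θ => Complex.norm_exp_ofReal_mul_I θ
  obtain ⟨ρ, hρ0, hρ⟩ : ∃ ρ : ℝ, 0 < ρ ∧ ∀ z, ρ < ‖z‖ → u z = 0 ∧ fderiv ℝ u z = 0 := by
    obtain ⟨ρ, hρ⟩ := hc.isCompact.isBounded.exists_norm_le
    refine ⟨max ρ 1, by positivity, fun z hz => ?_⟩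
    have hzn : z ∉ tsupport u := fun hz' =>
      absurd ((hρ z hz').trans (le_max_left _ 1)) (not_le.2 hz)
    exact ⟨image_eq_zero_of_notMem_tsupport hzn,
      image_eq_zero_of_notMem_tsupport fun h => hzn (tsupport_fderiv_subset ℝ h)⟩
  have hlarge : ∀ p : ℝ × ℝ, ρ < p.1 → ρ < ‖(p.1 : ℂ) * e p.2‖ := fun p hp => by
    rw [norm_mul, hnorm, mul_one, Complex.norm_real]; exact hp.trans_le (le_abs_self _)
  have hAi : IntegrableOn A (Ioi 0 ×ˢ Ioo (-Real.pi) Real.pi) :=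
    integrableOn_polar_of_eq_zero (ρ := ρ) hAc fun p hp => by
      simp [hAdef, (hρ _ (hlarge p hp)).2]
  have hBi : IntegrableOn B (Ioi 0 ×ˢ Ioo (-Real.pi) Real.pi) :=
    integrableOn_polar_of_eq_zero (ρ := ρ) hBc fun p hp => by
      simp [hBdef, (hρ _ (hlarge p hp)).2]
  have hpolar : ∀ p ∈ (Ioi 0 ×ˢ Ioo (-Real.pi) Real.pi : Set (ℝ × ℝ)),
      p.1 • (dbar u (Complex.polarCoord.symm p) * (Complex.polarCoord.symm p)⁻¹)
        = (1 / 2) * A p + (Complex.I / 2) * B p := by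
    rintro ⟨r, θ⟩ ⟨hr, -⟩
    have hr0 : (r : ℂ) ≠ 0 := by exact_mod_cast (ne_of_gt hr)
    have hP : Complex.polarCoord.symm (r, θ) = r * e θ := by
      simp [he, Complex.exp_mul_I]
    have hee : e θ = Real.cos θ • (1 : ℂ) + Real.sin θ • Complex.I := by
      simp [he, Complex.exp_mul_I]
    have hie : Complex.I * e θ = (-Real.sin θ) • (1 : ℂ) + Real.cos θ • Complex.I := by
      rw [hee]
      simp only [Complex.real_smul, Complex.ofReal_neg]
      linear_combination (Real.sin θ : ℂ) * Complex.I_mul_I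
    have hene : e θ ≠ 0 := Complex.exp_ne_zero _
    simp only [hP, hAdef, hBdef, dbar]
    set D := fderiv ℝ u (r * e θ)
    have hDe : D (e θ) = Real.cos θ * D 1 + Real.sin θ * D Complex.I := by
      rw [hee, map_add, map_smul, map_smul]; simp
    have hDi : D (Complex.I * e θ) = -Real.sin θ * D 1 + Real.cos θ * D Complex.I := by
      rw [hie, map_add, map_smul, map_smul]; simp
    have hcs : (Real.cos θ : ℂ) ^ 2 + (Real.sin θ : ℂ) ^ 2 = 1 := by
      exact_mod_cast Real.cos_sq_add_sin_sq θ
    rw [hDe, hDi, Complex.real_smul, mul_inv]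
    have hinv : (e θ)⁻¹ = Real.cos θ - Real.sin θ * Complex.I := by
      rw [inv_eq_iff_eq_inv, eq_comm, inv_eq_iff_eq_inv]
      refine (inv_eq_of_mul_eq_one_right ?_).symm
      rw [hee]; simp only [Complex.real_smul]
      linear_combination hcs - (Real.sin θ : ℂ) ^ 2 * Complex.I_sq
    rw [hinv]
    field_simp
    linear_combination (-(Real.sin θ : ℂ) * D Complex.I) * Complex.I_sq
  have hBint : ∫ p in Ioi 0 ×ˢ Ioo (-Real.pi) Real.pi, B p = 0 := by
    rw [Measure.volume_eq_prod] at hBi ⊢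
    rw [setIntegral_prod _ hBi]
    refine setIntegral_eq_zero_of_forall_eq_zero fun r hr => ?_
    have hr0 : (r : ℂ) ≠ 0 := by exact_mod_cast (ne_of_gt hr)
    have hder : ∀ θ ∈ uIcc (-Real.pi) Real.pi,
        HasDerivAt (fun θ : ℝ => u (r * e θ) / r) (B (r, θ)) θ := by
      intro θ _
      have h1 : HasDerivAt (fun θ : ℝ => (r : ℂ) * e θ) (r * (e θ * Complex.I)) θ := by
        have h2 : HasDerivAt (fun θ : ℝ => (θ : ℂ) * Complex.I) Complex.I θ := by
          simpa using (Complex.ofRealCLM.hasDerivAt (x := θ)).mul_const Complex.I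
        exact h2.cexp.const_mul _
      have h3 := ((hu.differentiable one_ne_zero (r * e θ)).hasFDerivAt.comp_hasDerivAt θ h1).div_const
        (r : ℂ)
      refine h3.congr_deriv ?_
      have : (r : ℂ) * (e θ * Complex.I) = r • (Complex.I * e θ) := by
        rw [Complex.real_smul]; ring
      rw [this, map_smul, Complex.real_smul, mul_div_cancel_left₀ _ hr0]
    rw [← integral_Ioc_eq_integral_Ioo,
      ← intervalIntegral.integral_of_le (by linarith [Real.pi_pos]),
      intervalIntegral.integral_eq_sub_of_hasDerivAt hder
        (Continuous.intervalIntegrable (hBc.comp (by fun_prop)) _ _)]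
    simp [he, Complex.exp_neg]
  have hAint : ∫ p in Ioi 0 ×ˢ Ioo (-Real.pi) Real.pi, A p = -(2 * Real.pi * u 0) := by
    rw [Measure.volume_eq_prod] at hAi ⊢
    rw [← setIntegral_prod_swap,
      setIntegral_prod (fun z : ℝ × ℝ => A z.swap) hAi.swap]
    have hin : ∀ θ, ∫ r in Ioi (0 : ℝ), A (r, θ) = -u 0 := by
      intro θ
      have hder : ∀ r : ℝ, HasDerivAt (fun r : ℝ => u (r * e θ)) (A (r, θ)) r := by
        intro r
        have h1 : HasDerivAt (fun r : ℝ => (r : ℂ) * e θ) (e θ) r := by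
          simpa using (Complex.ofRealCLM.hasDerivAt (x := r)).mul_const (e θ)
        exact (hu.differentiable one_ne_zero (r * e θ)).hasFDerivAt.comp_hasDerivAt r h1
      have hsupp : HasCompactSupport fun r : ℝ => u (r * e θ) := by
        refine HasCompactSupport.of_support_subset_isCompact (isCompact_closedBall (0 : ℝ) ρ) ?_
        intro r hr
        by_contra hn
        refine hr (hρ _ ?_).1
        rw [norm_mul, hnorm, mul_one, Complex.norm_real]
        simpa using hn
      have hcd : ContDiff ℝ 1 fun r : ℝ => u (r * e θ) :=
        hu.comp (Complex.ofRealCLM.contDiff.mul contDiff_const)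
      have := hsupp.integral_Ioi_deriv_eq hcd 0
      simpa [funext fun r => (hder r).deriv] using this
    simp only [Prod.swap_prod_mk, hin, setIntegral_const, Real.volume_real_Ioo_of_le
      (by linarith [Real.pi_pos] : -Real.pi ≤ Real.pi), Complex.real_smul]
    push_cast
    ring
  calc ∫ ζ, dbar u ζ * ζ⁻¹
      = ∫ p in Ioi 0 ×ˢ Ioo (-Real.pi) Real.pi, ((1 / 2) * A p + (Complex.I / 2) * B p) := by
        rw [← Complex.integral_comp_polarCoord_symm]
        exact setIntegral_congr_fun (measurableSet_Ioi.prod measurableSet_Ioo) hpolar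
    _ = -(Real.pi * u 0) := by
        rw [integral_add (hAi.const_mul _) (hBi.const_mul _), integral_const_mul,
          integral_const_mul, hAint, hBint]
        ring

/-- The **Cauchy–Pompeiu formula** for compactly supported functions. -/
theorem integral_dbar_mul_inv_sub {u : ℂ → ℂ} (hu : ContDiff ℝ 1 u) (hc : HasCompactSupport u)
    (z : ℂ) : ∫ ζ, dbar u ζ * (ζ - z)⁻¹ = -(Real.pi * u z) := by
  have h := integral_dbar_mul_inv (u := fun ζ => u (ζ + z)) (by fun_prop)
    (hc.comp_homeomorph (Homeomorph.addRight z))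
  rw [← integral_add_right_eq_self _ z]
  simpa [dbar, fderiv_comp_add_right] using h

/-! ### The Cauchy kernel modulo polynomials -/

/-- The identity function of `K`, as an element of the Banach algebra `C(K, ℂ)`. -/
noncomputable def coordinateOn (K : Set ℂ) : C(K, ℂ) := ⟨Subtype.val, continuous_subtype_val⟩

/-- The polynomial functions of degree at most `n` on `K`. -/
noncomputable def polynomialsOn (K : Set ℂ) (n : ℕ) : Submodule ℂ C(K, ℂ) :=
  Submodule.span ℂ ((fun i => coordinateOn K ^ i) '' Iic n)

instance (K : Set ℂ) (n : ℕ) : FiniteDimensional ℂ (polynomialsOn K n) :=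
  FiniteDimensional.span_of_finite ℂ ((finite_Iic n).image _)

theorem exists_polynomial_of_mem_polynomialsOn {K : Set ℂ} {n : ℕ} {φ : C(K, ℂ)}
    (hφ : φ ∈ polynomialsOn K n) :
    ∃ p : Polynomial ℂ, p.natDegree ≤ n ∧ ∀ x : K, p.eval (x : ℂ) = φ x := by
  induction hφ using Submodule.span_induction with
  | mem φ h =>
    obtain ⟨i, hi, rfl⟩ := h
    exact ⟨Polynomial.X ^ i, (Polynomial.natDegree_X_pow_le i).trans hi,
      fun x => by simp [coordinateOn]⟩
  | zero => exact ⟨0, by simp, by simp⟩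
  | add φ ψ _ _ h1 h2 =>
    obtain ⟨p, hp, hpφ⟩ := h1
    obtain ⟨q, hq, hqψ⟩ := h2
    exact ⟨p + q, (Polynomial.natDegree_add_le _ _).trans (max_le hp hq),
      fun x => by simp [hpφ, hqψ]⟩
  | smul c φ _ h =>
    obtain ⟨p, hp, hpφ⟩ := h
    exact ⟨c • p, (Polynomial.natDegree_smul_le _ _).trans hp, fun x => by simp [hpφ]⟩

theorem mem_resolventSet_coordinateOn {K : Set ℂ} {ζ : ℂ} (hζ : ζ ∉ K) :
    ζ ∈ resolventSet ℂ (coordinateOn K) := by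
  have : ζ ∉ spectrum ℂ (coordinateOn K) := by
    rw [ContinuousMap.spectrum_eq_range]
    rintro ⟨x, rfl⟩
    exact hζ x.2
  simpa [spectrum] using this

theorem sub_mul_resolvent_coordinateOn {K : Set ℂ} {ζ : ℂ} (hζ : ζ ∉ K) :
    (algebraMap ℂ C(K, ℂ) ζ - coordinateOn K) * resolvent (coordinateOn K) ζ = 1 :=
  Ring.mul_inverse_cancel _ (mem_resolventSet_coordinateOn hζ)

theorem resolvent_coordinateOn_apply {K : Set ℂ} {ζ : ℂ} (hζ : ζ ∉ K) (x : K) :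
    resolvent (coordinateOn K) ζ x = (ζ - x)⁻¹ := by
  have h := congrArg (fun φ : C(K, ℂ) => φ x) (sub_mul_resolvent_coordinateOn hζ)
  exact eq_inv_of_mul_eq_one_right (by simpa [coordinateOn] using h)

section

variable {K : Set ℂ} [CompactSpace K]

instance (n : ℕ) : IsClosed (polynomialsOn K n : Set C(K, ℂ)) :=
  Submodule.closed_of_finiteDimensional _

/-- The quotient norm is the distance to the polynomials, so errors can be estimated linearly, under
the integral sign. -/
theorem approxError_le_norm_mkQ {f : ℂ → ℂ} {φ : C(K, ℂ)} (h : ∀ x : K, φ x = f x) (n : ℕ) :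
    approxError n f K ≤ ‖(polynomialsOn K n).mkQL φ‖ := by
  refine le_of_forall_pos_lt_add fun ε hε => ?_
  obtain ⟨m, hm, hmlt⟩ := Submodule.Quotient.norm_mk_lt ((polynomialsOn K n).mkQL φ) hε
  have hmem : φ - m ∈ polynomialsOn K n := by
    rw [← Submodule.Quotient.eq]; exact hm.symm
  obtain ⟨p, hp, hpe⟩ := exists_polynomial_of_mem_polynomialsOn hmem
  refine ((approxError_le hp f K).trans (supNormOn_le (norm_nonneg m) fun z hz => ?_)).trans_lt hmlt
  have h1 := hpe ⟨z, hz⟩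
  have h2 : f z - p.eval z = m ⟨z, hz⟩ := by
    rw [show p.eval z = φ ⟨z, hz⟩ - m ⟨z, hz⟩ from h1, h ⟨z, hz⟩]; ring
  rw [h2]
  exact m.norm_coe_le_norm _

theorem differentiableAt_resolvent_coordinateOn {ζ : ℂ} (hζ : ζ ∉ K) :
    DifferentiableAt ℂ (resolvent (coordinateOn K)) ζ :=
  (spectrum.hasDerivAt_resolvent_const_left (mem_resolventSet_coordinateOn hζ)).differentiableAt

theorem norm_mkQ_le (n : ℕ) (φ : C(K, ℂ)) : ‖(polynomialsOn K n).mkQL φ‖ ≤ ‖φ‖ :=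
  Submodule.Quotient.norm_mk_le _ φ

/-- `(ζ^{n+1} - x^{n+1}) / (ζ - x)` is a polynomial in `x` of degree at most `n`. -/
theorem pow_smul_mkQ_resolvent {ζ : ℂ} (hζ : ζ ∉ K) (n : ℕ) :
    ζ ^ (n + 1) • (polynomialsOn K n).mkQL (resolvent (coordinateOn K) ζ) =
      (polynomialsOn K n).mkQL (coordinateOn K ^ (n + 1) * resolvent (coordinateOn K) ζ) := by
  set a := coordinateOn K with ha
  set r := resolvent a ζ
  rw [← map_smul, ← sub_eq_zero, ← map_sub]
  refine (Submodule.Quotient.mk_eq_zero _).2 ?_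
  have h : ζ ^ (n + 1) • r - a ^ (n + 1) * r =
      ∑ i ∈ Finset.range (n + 1), ζ ^ i • a ^ (n - i) := by
    have h1 := geom_sum₂_mul (algebraMap ℂ C(K, ℂ) ζ) a (n + 1)
    calc ζ ^ (n + 1) • r - a ^ (n + 1) * r
        = ((algebraMap ℂ C(K, ℂ) ζ) ^ (n + 1) - a ^ (n + 1)) * r := by
          rw [sub_mul, ← map_pow, ← Algebra.smul_def]
      _ = (∑ i ∈ Finset.range (n + 1), (algebraMap ℂ C(K, ℂ) ζ) ^ i * a ^ (n + 1 - 1 - i)) := by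
          rw [← h1, mul_assoc, sub_mul_resolvent_coordinateOn hζ, mul_one]
      _ = _ := by simp only [← map_pow, ← Algebra.smul_def, Nat.add_sub_cancel]
  rw [h]
  refine Submodule.sum_mem _ fun i _ => Submodule.smul_mem _ _ (Submodule.subset_span ?_)
  exact ⟨n - i, Nat.sub_le n i, rfl⟩

variable {g : ℂ → ℝ}

/-- `exp ((n+1) g)` grows like `|ζ|^{n+1}`, which `pow_smul_mkQ_resolvent` absorbs; the remaining
resolvent tends to 0. -/
theorem IsGreenFunction.tendsto_norm_mkQ_resolvent (hg : IsGreenFunction K g) (n : ℕ) :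
    Tendsto (fun ζ => ‖(polynomialsOn K n).mkQL (resolvent (coordinateOn K) ζ)‖ *
      Real.exp ((n + 1 : ℝ) * g ζ)) (cocompact ℂ) (𝓝 0) := by
  obtain ⟨C, hC⟩ := hg.exists_norm_le_exp
  have h1 : Tendsto (fun ζ => ‖coordinateOn K ^ (n + 1)‖ * Real.exp C ^ (n + 1) *
      ‖resolvent (coordinateOn K) ζ‖) (cocompact ℂ) (𝓝 0) := by
    have h := (spectrum.resolvent_tendsto_cobounded (𝕜 := ℂ) (coordinateOn K)).norm.const_mul
      (‖coordinateOn K ^ (n + 1)‖ * Real.exp C ^ (n + 1))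
    rw [Metric.cobounded_eq_cocompact] at h
    simpa using h
  refine squeeze_zero' (Eventually.of_forall fun z => by positivity) ?_ h1
  filter_upwards [hC, hg.tendsto_cocompact.eventually_gt_atTop 0] with ζ hζ hζ0
  have hζK := hg.notMem_of_pos hζ0
  have hexp : Real.exp ((n + 1 : ℝ) * g ζ) ≤ (Real.exp C * ‖ζ‖) ^ (n + 1) := by
    have := Real.exp_nat_mul (g ζ) (n + 1)
    push_cast at this
    rw [this]
    exact pow_le_pow_left₀ (Real.exp_pos _).le hζ.2.2 _
  calc _ ≤ ‖(polynomialsOn K n).mkQL (resolvent (coordinateOn K) ζ)‖ *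
        (Real.exp C * ‖ζ‖) ^ (n + 1) := by gcongr
    _ = ‖ζ ^ (n + 1) • (polynomialsOn K n).mkQL (resolvent (coordinateOn K) ζ)‖ *
        Real.exp C ^ (n + 1) := by rw [norm_smul, norm_pow]; ring
    _ ≤ ‖coordinateOn K ^ (n + 1)‖ * ‖resolvent (coordinateOn K) ζ‖ * Real.exp C ^ (n + 1) := by
        rw [pow_smul_mkQ_resolvent hζK]
        gcongr
        exact (norm_mkQ_le _ _).trans (norm_mul_le _ _)
    _ = _ := by ring

/-- Maximum principle on `g > s`. On the compact level set `g = s` the resolvent itself is bounded,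
and quotient maps do not increase norms, so `C` is independent of `n`. -/
theorem IsGreenFunction.exists_norm_mkQ_resolvent_le (hg : IsGreenFunction K g) {s : ℝ}
    (hs : 0 < s) : ∃ C, 0 ≤ C ∧ ∀ n : ℕ, ∀ ζ, s ≤ g ζ →
      ‖(polynomialsOn K n).mkQL (resolvent (coordinateOn K) ζ)‖ ≤
        C * Real.exp ((n + 1 : ℝ) * (s - g ζ)) := by
  have hcomp : IsCompact {ζ | g ζ = s} :=
    (hg.isCompact_setOf_le s).of_isClosed_subset (isClosed_eq hg.continuous continuous_const)
      fun ζ hζ => le_of_eq hζ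
  obtain ⟨C, hC⟩ := hcomp.exists_bound_of_continuousOn (f := resolvent (coordinateOn K))
    fun ζ hζ => (differentiableAt_resolvent_coordinateOn
      (hg.notMem_of_pos (hs.trans_eq (show g ζ = s from hζ).symm))).continuousAt.continuousWithinAt
  refine ⟨max C 0, le_max_right _ _, fun n ζ hζ => ?_⟩
  have hbd : ∀ w, g w = s → ‖(polynomialsOn K n).mkQL (resolvent (coordinateOn K) w)‖ ≤ max C 0 :=
    fun w hw => (norm_mkQ_le _ _).trans ((hC w hw).trans (le_max_left _ _))
  rcases hζ.eq_or_lt with heq | hlt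
  · rw [← heq]; simpa using hbd ζ heq.symm
  have hd : DiffContOnCl ℂ (fun ζ => (polynomialsOn K n).mkQL (resolvent (coordinateOn K) ζ))
      {ζ | s < g ζ} := by
    refine DifferentiableOn.diffContOnCl fun w hw => ?_
    have hw' : s ≤ g w := closure_lt_subset_le continuous_const hg.continuous hw
    exact ((polynomialsOn K n).mkQL.differentiableAt.comp w
      (differentiableAt_resolvent_coordinateOn
        (hg.notMem_of_pos (hs.trans_le hw')))).differentiableWithinAt
  have h := norm_mul_exp_harmonic_le_of_forall_mem_frontier
    (isOpen_lt continuous_const hg.continuous) hd hg.continuous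
    (fun w hw => hg.harmonic w (hg.notMem_of_pos (hs.trans hw))) (n + 1 : ℝ)
    (hg.tendsto_norm_mkQ_resolvent n) (M := max C 0 * Real.exp ((n + 1 : ℝ) * s)) (by positivity)
    (fun w hw => by
      have hw' : s = g w := frontier_lt_subset_eq continuous_const hg.continuous hw
      rw [← hw']
      gcongr
      exact hbd w hw'.symm) hlt
  rw [← le_div_iff₀ (Real.exp_pos _), mul_div_assoc, ← Real.exp_sub, ← mul_sub] at h
  exact h

end

/-! ### From holomorphic extension to approximation -/

theorem dbar_eq_zero_of_differentiableAt {u : ℂ → ℂ} {z : ℂ} (hu : DifferentiableAt ℂ u z) :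
    dbar u z = 0 := by
  have h1 : fderiv ℝ u z = (fderiv ℂ u z).restrictScalars ℝ := hu.fderiv_restrictScalars ℝ
  have h2 : fderiv ℂ u z Complex.I = Complex.I * fderiv ℂ u z 1 := by
    rw [← smul_eq_mul, ← map_smul, smul_eq_mul, mul_one]
  simp only [dbar, h1, ContinuousLinearMap.coe_restrictScalars', h2]
  linear_combination (fderiv ℂ u z 1 / 2) * Complex.I_mul_I

/-- A holomorphic function on a Green sublevel set, cut off smoothly. -/
theorem IsGreenFunction.exists_contDiff_cutoff {K : Set ℂ} {g : ℂ → ℝ} (hg : IsGreenFunction K g)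
    {b c : ℝ} (hb : 0 < b) (hbc : b < c) {F : ℂ → ℂ} (hF : DifferentiableOn ℂ F {z | g z < c}) :
    ∃ u : ℂ → ℂ, ContDiff ℝ 1 u ∧ HasCompactSupport u ∧ ∀ z, g z < b → u =ᶠ[𝓝 z] F := by
  obtain ⟨d, hbd, hdc⟩ := exists_between hbc
  set χ : ℂ → ℝ := fun z => Real.smoothTransition ((d - g z) / (d - b)) with hχ
  have hgc := hg.continuous
  have hdb : 0 < d - b := sub_pos.2 hbd
  have hone : ∀ z, g z < b → χ =ᶠ[𝓝 z] fun _ => 1 := fun z hz => by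
    filter_upwards [hgc.continuousAt.eventually_lt_const hz] with w hw
    refine Real.smoothTransition.one_of_one_le ?_
    rw [le_div_iff₀ hdb]; linarith
  have hzero : ∀ z, d ≤ g z → χ z = 0 := fun z hz =>
    Real.smoothTransition.zero_of_nonpos (div_nonpos_of_nonpos_of_nonneg (by linarith) hdb.le)
  refine ⟨fun z => (χ z : ℂ) * F z, ?_, ?_, fun z hz => ?_⟩
  · rw [contDiff_iff_contDiffAt]
    intro z
    rcases lt_or_ge (g z) c with hz | hz
    · have hFz : ContDiffAt ℝ 1 F z :=
        (hF.contDiffOn (isOpen_lt hgc continuous_const)|>.contDiffAt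
          ((isOpen_lt hgc continuous_const).mem_nhds hz)).restrict_scalars ℝ
      have hχz : ContDiffAt ℝ 1 χ z := by
        -- `g` may fail to be smooth at points of `K`, but there the cutoff is locally constant.
        rcases lt_or_ge (g z) b with hzb | hzb
        · exact contDiffAt_const.congr_of_eventuallyEq (hone z hzb)
        · have hzK : z ∉ K := fun h => by linarith [hg.eq_zero z h]
          have hgz : ContDiffAt ℝ 1 g z := (hg.harmonic z hzK).1.of_le (by norm_num)
          exact Real.smoothTransition.contDiff.contDiffAt.comp z
            ((contDiffAt_const.sub hgz).div_const _)
      exact (Complex.ofRealCLM.contDiff.contDiffAt.comp z hχz).mul hFz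
    · refine (contDiffAt_const (c := (0 : ℂ))).congr_of_eventuallyEq ?_
      filter_upwards [hgc.continuousAt.eventually_const_lt (hdc.trans_le hz)] with w hw
      simp [hzero w hw.le]
  · refine HasCompactSupport.intro (hg.isCompact_setOf_le d) fun z hz => ?_
    simp [hzero z (not_le.1 hz).le]
  · filter_upwards [hone z hz] with w hw
    simp [hw]

/-- Cauchy–Pompeiu makes `f` a `C(K, ℂ)`-valued integral of `dbar u` times the resolvent. Since
`dbar u` vanishes where `g < b`, passing to the quotient leaves only kernels of size at most `C exp
((n+1)(s - b))`. -/
theorem IsGreenFunction.exists_approxError_le {K : Set ℂ} {g : ℂ → ℝ} (hg : IsGreenFunction K g)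
    (hK : IsCompact K) {s b c : ℝ} (hs : 0 < s) (hsb : s ≤ b) (hbc : b < c) {F f : ℂ → ℂ}
    (hF : DifferentiableOn ℂ F {z | g z < c}) (hFf : EqOn F f K) :
    ∃ C, ∀ n : ℕ, approxError n f K ≤ C * Real.exp (s - b) ^ n := by
  have : CompactSpace K := isCompact_iff_compactSpace.1 hK
  have hb : 0 < b := hs.trans_le hsb
  obtain ⟨u, hu, hucs, huF⟩ := hg.exists_contDiff_cutoff hb hbc hF
  have hdz : ∀ ζ, g ζ < b → dbar u ζ = 0 := fun ζ hζ => by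
    refine dbar_eq_zero_of_differentiableAt ?_
    refine DifferentiableAt.congr_of_eventuallyEq ?_ (huF ζ hζ)
    exact hF.differentiableAt
      ((isOpen_lt hg.continuous continuous_const).mem_nhds (show g ζ < c from hζ.trans hbc))
  have hfc := hu.continuous_fderiv one_ne_zero
  have hdc : Continuous (dbar u) := by unfold dbar; fun_prop
  have hdcs : HasCompactSupport (dbar u) := by
    refine (hucs.fderiv (𝕜 := ℝ)).mono' fun z hz => ?_
    refine subset_tsupport _ fun h0 => hz ?_
    simp [dbar, h0]
  set Φ : ℂ → C(K, ℂ) := fun ζ => dbar u ζ • resolvent (coordinateOn K) ζ with hΦ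
  -- On `K` the resolvent is a default value, harmless because `dbar u` vanishes near `K`.
  have hΦc : Continuous Φ := by
    rw [continuous_iff_continuousAt]
    intro ζ
    by_cases hζ : ζ ∈ K
    · have h0 : Φ =ᶠ[𝓝 ζ] fun _ => 0 := by
        filter_upwards [hg.continuous.continuousAt.eventually_lt_const
          ((hg.eq_zero ζ hζ).trans_lt hb)] with w hw
        simp [hΦ, hdz w hw]
      exact continuousAt_const.congr h0.symm
    · exact hdc.continuousAt.smul (differentiableAt_resolvent_coordinateOn hζ).continuousAt
  have hΦi : Integrable Φ := hΦc.integrable_of_hasCompactSupport hdcs.smul_right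
  obtain ⟨C, hC0, hC⟩ := hg.exists_norm_mkQ_resolvent_le hs
  set φ : C(K, ℂ) := (-(Real.pi : ℂ)⁻¹) • ∫ ζ, Φ ζ with hφ
  have hφf : ∀ x : K, φ x = f x := by
    intro x
    have h1 : (∫ ζ, Φ ζ) x = ∫ ζ, dbar u ζ * (ζ - x)⁻¹ := by
      have h2 := (ContinuousMap.evalCLM (M := ℂ) ℂ x).integral_comp_comm hΦi
      refine Eq.trans h2.symm (integral_congr_ae (Eventually.of_forall fun ζ => ?_))
      change dbar u ζ * resolvent (coordinateOn K) ζ x = _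
      by_cases hζ : ζ ∈ K
      · simp [hdz ζ ((hg.eq_zero ζ hζ).trans_lt hb)]
      · rw [resolvent_coordinateOn_apply hζ]
    have hux : u x = f x :=
      (huF x ((hg.eq_zero x x.2).trans_lt hb)).self_of_nhds.trans (hFf x.2)
    have hpi : (Real.pi : ℂ) ≠ 0 := by exact_mod_cast Real.pi_ne_zero
    rw [hφ, ContinuousMap.smul_apply, h1, integral_dbar_mul_inv_sub hu hucs, hux, smul_eq_mul]
    field_simp
  have hdi : Integrable fun ζ => ‖dbar u ζ‖ := (hdc.integrable_of_hasCompactSupport hdcs).norm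
  refine ⟨Real.pi⁻¹ * ((∫ ζ, ‖dbar u ζ‖) * (C * Real.exp (s - b))), fun n => ?_⟩
  have hpow : Real.exp ((n + 1 : ℝ) * (s - b)) = Real.exp (s - b) ^ (n + 1) := by
    rw [← Real.exp_nat_mul]; push_cast; rfl
  have hint : ‖∫ ζ, (polynomialsOn K n).mkQL (Φ ζ)‖ ≤
      ∫ ζ, ‖dbar u ζ‖ * (C * Real.exp (s - b) ^ (n + 1)) := by
    refine norm_integral_le_of_norm_le (hdi.mul_const _) (Eventually.of_forall fun ζ => ?_)
    rw [hΦ]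
    simp only [map_smul, norm_smul]
    rcases lt_or_ge (g ζ) b with hζ | hζ
    · simp [hdz ζ hζ]
    · gcongr
      refine (hC n ζ (hsb.trans hζ)).trans ?_
      rw [← hpow]
      gcongr
  calc approxError n f K ≤ ‖(polynomialsOn K n).mkQL φ‖ := approxError_le_norm_mkQ hφf n
    _ = Real.pi⁻¹ * ‖∫ ζ, (polynomialsOn K n).mkQL (Φ ζ)‖ := by
        rw [hφ, map_smul, norm_smul, ContinuousLinearMap.integral_comp_comm _ hΦi]
        simp [abs_of_pos Real.pi_pos]
    _ ≤ Real.pi⁻¹ * ∫ ζ, ‖dbar u ζ‖ * (C * Real.exp (s - b) ^ (n + 1)) := by gcongr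
    _ = _ := by rw [integral_mul_const]; ring

theorem IsGreenFunction.limsup_le_of_differentiableOn {K : Set ℂ} {g : ℂ → ℝ}
    (hg : IsGreenFunction K g) (hK : IsCompact K) {R : ℝ} (hR : 1 < R) {F f : ℂ → ℂ}
    (hF : DifferentiableOn ℂ F (greenSublevel g R)) (hFf : EqOn F f K) :
    limsup (fun n : ℕ => approxError n f K ^ (1 / (n : ℝ))) atTop ≤ 1 / R := by
  have hlog : 0 < Real.log R := Real.log_pos hR
  have key : ∀ ε ∈ Ioo 0 (Real.log R / 2),
      limsup (fun n : ℕ => approxError n f K ^ (1 / (n : ℝ))) atTop ≤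
        Real.exp (2 * ε - Real.log R) := by
    rintro ε ⟨hε, hε2⟩
    -- With `s = ε`, the condition `s ≤ b` is where `ε < log R / 2` enters; the rate is `exp (2ε -
    -- log R)`.
    obtain ⟨C, hC⟩ := hg.exists_approxError_le hK hε (b := Real.log R - ε) (by linarith)
      (by linarith) hF hFf
    refine limsup_approxError_rpow_le (C := C) (Real.exp_pos _) fun n => (hC n).trans_eq ?_
    ring_nf
  have hlim : Tendsto (fun ε => Real.exp (2 * ε - Real.log R)) (𝓝[>] 0)
      (𝓝 (Real.exp (2 * 0 - Real.log R))) :=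
    ((by fun_prop : Continuous fun ε => Real.exp (2 * ε - Real.log R)).tendsto 0).mono_left
      nhdsWithin_le_nhds
  have h := ge_of_tendsto hlim
    (eventually_of_mem (Ioo_mem_nhdsGT (by positivity : 0 < Real.log R / 2)) key)
  rwa [mul_zero, zero_sub, Real.exp_neg, Real.exp_log (one_pos.trans hR), ← one_div] at h

theorem mainTheorem1 (K : Set ℂ) (hK : IsCompact K) (g : ℂ → ℝ) (hg : IsGreenFunction K g)
    (R : ℝ) (hR : 1 < R) (f : ℂ → ℂ) (hf : ContinuousOn f K) :
    Filter.limsup (fun n : ℕ => approxError n f K ^ (1 / (n : ℝ))) Filter.atTop ≤ 1 / R ↔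
      ∃ F : ℂ → ℂ, DifferentiableOn ℂ F (greenSublevel g R) ∧ Set.EqOn F f K :=
  ⟨hg.exists_differentiableOn_of_limsup_le hK hR hf,
    fun ⟨_, hF, hFf⟩ => hg.limsup_le_of_differentiableOn hK hR hF hFf⟩
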